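/- Let $F:\mathbb R^2\times\mathbb R^2\to\mathbb R$ be a continuous function such that, for all $p,q,q_1,q_2\in\mathbb R^2$, $\theta\in[0,1]$ and $\lambda>0$, $$F(p,\theta q_1+(1-\theta)q_2)\le\theta F(p,q_1)+(1-\theta)F(p,q_2),\qquad F(p,\lambda q)=\lambda F(p,q),$$ and such that there exist constants $m_1,m_2>0$ with $m_1|q|\le F(p,q)\le m_2|q|$ for all $p,q\in\mathbb R^2$. Suppose that there is a continuous function $F_\infty:\mathbb R^2\times\mathbb R^2\to\mathbb R$ with $F_\infty(p+n,q)=F_\infty(p,q)$ for all $p,q\in\mathbb R^2$, $n\in\mathbb Z^2$, and such that for every $q\in\mathbb R^2$ one has $F(p,q)-F_\infty(p,q)\to0$ as $|p|\to+\infty$. Let $W^{1,1}$ be the space of $1$-periodic (continuous) maps $u\in W^{1,1}_{loc}(\mathbb R;\mathbb R^2)$, let $\dot u$ denote the weak derivative of $u$ and let $i$ denote the counterclockwise rotation of $\mathbb R^2$ by $\pi/2$. For $\tau\in\mathbb R$ put $$\mathcal M_\tau=\Big\{u\in W^{1,1}\ :\ \mathcal A(u)=\tfrac12\int_0^1u\cdot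 i\dot u\,dt=\tau\Big\},\qquad S_G(\tau)=\inf_{u\in\mathcal M_\tau}\int_0^1G(u,\dot u)\,dt\quad\text{for }G=F,F_\infty.$$ Then $S_F(\tau)\le S_{F_\infty}(\tau)$ for every $\tau\in\mathbb R$. Moreover, if $S_F(\tau)<S_{F_\infty}(\tau)$ for a given $\tau\in\mathbb R$, then there exists a Lipschitz continuous $u_\tau\in\mathcal M_\tau$ such that $\int_0^1F(u_\tau,\dot u_\tau)\,dt=S_F(\tau)$. -/

import Mathlib

open MeasureTheory Filter Topology
open scoped ContDiff

/-- The Euclidean plane `ℝ²`. -/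
abbrev Plane : Type := EuclideanSpace ℝ (Fin 2)

/-- Rotation of the plane by `π / 2` counterclockwise, i.e. multiplication by the imaginary
unit under the identification `ℝ² = ℂ`. -/
noncomputable def rot (q : Plane) : Plane := !₂[-(q 1), q 0]

/-- The point of the lattice `ℤ²` in the plane with coordinates `n`. -/
noncomputable def latticePoint (n : Fin 2 → ℤ) : Plane := WithLp.toLp 2 (fun i => (n i : ℝ))

/-- `g` is a weak (distributional) derivative on `ℝ` of `u`; both functions are in `L¹_loc`,
and test functions are smooth and compactly supported. -/
structure HasWeakDeriv (u g : ℝ → Plane) : Prop where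
  locallyIntegrable : LocallyIntegrable u volume
  locallyIntegrable_deriv : LocallyIntegrable g volume
  integral_eq : ∀ φ : ℝ → ℝ, ContDiff ℝ ∞ φ → HasCompactSupport φ →
    ∫ t, deriv φ t • u t = - ∫ t, φ t • g t

open Classical in
/-- The weak derivative of `u` (unique up to a null set), and `0` if there is none. -/
noncomputable def weakDeriv (u : ℝ → Plane) : ℝ → Plane :=
  if h : ∃ g, HasWeakDeriv u g then h.choose else 0

/-- The space `W^{1,1}(ℝ/ℤ; ℝ²)` of `1`-periodic maps in `W^{1,1}_loc(ℝ; ℝ²)`, each class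
being represented by its continuous representative. -/
def sobolevLoops : Set (ℝ → Plane) :=
  {u | Continuous u ∧ Function.Periodic u 1 ∧ ∃ g, HasWeakDeriv u g}

/-- The functional `u ↦ ∫₀¹ F(u, u̇) dt`. -/
noncomputable def energy (F : Plane → Plane → ℝ) (u : ℝ → Plane) : ℝ :=
  ∫ t in (0 : ℝ)..1, F (u t) (weakDeriv u t)

/-- The signed area `𝒜(u) = (1/2) ∫₀¹ u · i u̇ dt`. -/
noncomputable def signedArea (u : ℝ → Plane) : ℝ :=
  (1 / 2) * ∫ t in (0 : ℝ)..1, inner ℝ (u t) (rot (weakDeriv u t))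

/-- The constraint set `{u ∈ W^{1,1} | 𝒜(u) = τ}`. -/
def areaClass (τ : ℝ) : Set (ℝ → Plane) :=
  {u | u ∈ sobolevLoops ∧ signedArea u = τ}

/-- `S_F(τ)`, the infimum of the functional of `F` on the curves of area `τ`. -/
noncomputable def minEnergy (F : Plane → Plane → ℝ) (τ : ℝ) : ℝ :=
  sInf (energy F '' areaClass τ)

/-- The structural hypotheses on a length density `F = F(p, q)`: continuity, convexity and
positive homogeneity of degree one in `q`, and uniform bounds by multiples of `|q|`. -/
structure IsLengthDensity (F : Plane → Plane → ℝ) : Prop where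
  continuous : Continuous fun x : Plane × Plane => F x.1 x.2
  convex : ∀ p q₁ q₂ : Plane, ∀ θ : ℝ, 0 ≤ θ → θ ≤ 1 →
    F p (θ • q₁ + (1 - θ) • q₂) ≤ θ * F p q₁ + (1 - θ) * F p q₂
  homogeneous : ∀ p q : Plane, ∀ c : ℝ, 0 < c → F p (c • q) = c * F p q
  bounds : ∃ m₁ m₂ : ℝ, 0 < m₁ ∧ 0 < m₂ ∧
    ∀ p q : Plane, m₁ * ‖q‖ ≤ F p q ∧ F p q ≤ m₂ * ‖q‖

/-- `F` is asymptotic to the continuous, `ℤ²`-periodic Lagrangian `Finf` as `|p| → ∞`,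
pointwise in `q`. -/
structure IsAsymptoticToPeriodic (F Finf : Plane → Plane → ℝ) : Prop where
  continuous : Continuous fun x : Plane × Plane => Finf x.1 x.2
  periodic : ∀ p q : Plane, ∀ n : Fin 2 → ℤ, Finf (p + latticePoint n) q = Finf p q
  tendsto : ∀ q : Plane,
    Tendsto (fun p : Plane => F p q - Finf p q) (Bornology.cobounded Plane) (𝓝 0)

/-! The inequality comes from pushing competitors to infinity. Translating a loop by a far lattice
vector changes neither its area nor its `Finf`-energy, while its `F`-energy approaches its
`Finf`-energy, because `F p q - Finf p q` is small compared with `‖q‖`, uniformly in `q`, once `‖p‖`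
is large (`exists_forall_abs_sub_le`).

Existence is the direct method with a concentration dichotomy. The lower bound on `F` controls the
lengths of near-minimizers. Area and energy are invariant under reparametrization, so a minimizing
sequence can be taken equi-Lipschitz (`exists_lipschitz_reparametrization`), and each loop then
stays within a fixed distance of its base point. If the base points escape to infinity, the `F`- and
`Finf`-energies merge and `minEnergy Finf τ ≤ minEnergy F τ`, which the strict inequality forbids.
Otherwise a subsequence is bounded and Arzelà–Ascoli gives a Lipschitz limit. Lower semicontinuity
for Lagrangians convex in the velocity (`integral_lagrangian_le_of_tendsto`) bounds its energy;
applied to plus and minus the area integrand, which is linear in the velocity, it also shows that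
the area passes to the limit. -/

/-! ### Weak derivatives and the fundamental theorem of calculus -/

theorem Real.smoothTransition.deriv_eq_zero {x : ℝ} (hx : x < 0 ∨ 1 < x) :
    deriv Real.smoothTransition x = 0 := by
  rcases hx with hx | hx
  · have : Real.smoothTransition =ᶠ[𝓝 x] fun _ => 0 := by
      filter_upwards [Iio_mem_nhds hx] with y hy
      exact Real.smoothTransition.zero_of_nonpos (le_of_lt hy)
    rw [this.deriv_eq, deriv_const]
  · have : Real.smoothTransition =ᶠ[𝓝 x] fun _ => 1 := by
      filter_upwards [Ioi_mem_nhds hx] with y hy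
      exact Real.smoothTransition.one_of_one_le (le_of_lt hy)
    rw [this.deriv_eq, deriv_const]

theorem Real.smoothTransition.continuous_deriv : Continuous (deriv Real.smoothTransition) :=
  (Real.smoothTransition.contDiff (n := 1)).continuous_deriv le_rfl

theorem Real.smoothTransition.differentiable : Differentiable ℝ Real.smoothTransition :=
  (Real.smoothTransition.contDiff (n := 1)).differentiable one_ne_zero

theorem Real.smoothTransition.hasCompactSupport_deriv :
    HasCompactSupport (deriv Real.smoothTransition) := by
  refine HasCompactSupport.intro (isCompact_Icc (a := (0 : ℝ)) (b := 1)) fun x hx => ?_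
  apply Real.smoothTransition.deriv_eq_zero
  by_contra! h
  exact hx ⟨h.1, h.2⟩

theorem Real.smoothTransition.integral_deriv : ∫ x, deriv Real.smoothTransition x = 1 := by
  have h1 : ∫ x in (0 : ℝ)..1, deriv Real.smoothTransition x = 1 := by
    rw [intervalIntegral.integral_deriv_eq_sub
      (fun x _ => Real.smoothTransition.differentiable x)
      (Real.smoothTransition.continuous_deriv.intervalIntegrable _ _)]
    simp
  rw [← h1, intervalIntegral.integral_of_le zero_le_one, ← integral_Icc_eq_integral_Ioc]
  refine (setIntegral_eq_integral_of_forall_compl_eq_zero fun x hx => ?_).symm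
  apply Real.smoothTransition.deriv_eq_zero
  by_contra! h
  exact hx ⟨h.1, h.2⟩

/-- The smooth steps `x ↦ s (n (x - a))` have derivatives converging to the Dirac mass at `a`. -/
theorem tendsto_integral_deriv_smoothTransition_smul {u : ℝ → Plane} (hu : Continuous u) (a : ℝ) :
    Tendsto (fun n : ℕ => ∫ x, (((n : ℝ) + 1) *
      deriv Real.smoothTransition (((n : ℝ) + 1) * (x - a))) • u x) atTop (𝓝 (u a)) := by
  have hsub : ∀ n : ℕ, ∫ x, (((n : ℝ) + 1) *
      deriv Real.smoothTransition (((n : ℝ) + 1) * (x - a))) • u x =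
      ∫ y, deriv Real.smoothTransition y • u (a + ((n : ℝ) + 1)⁻¹ * y) := by
    intro n
    have hn : (0 : ℝ) < (n : ℝ) + 1 := by positivity
    have e1 := integral_sub_right_eq_self (μ := volume) (fun x => (((n : ℝ) + 1) *
      deriv Real.smoothTransition (((n : ℝ) + 1) * x)) • u (a + x)) a
    simp only [add_sub_cancel] at e1
    rw [e1]
    have e2 := Measure.integral_comp_mul_left (fun y => deriv Real.smoothTransition y •
      u (a + ((n : ℝ) + 1)⁻¹ * y)) ((n : ℝ) + 1)
    simp only [inv_mul_cancel_left₀ hn.ne'] at e2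
    simp only [mul_smul]
    rw [integral_smul, e2, abs_of_pos (inv_pos.2 hn), smul_smul, mul_inv_cancel₀ hn.ne', one_smul]
  simp only [hsub]
  have hlim : ∫ y, deriv Real.smoothTransition y • u a = u a := by
    rw [integral_smul_const, Real.smoothTransition.integral_deriv, one_smul]
  rw [← hlim]
  obtain ⟨M, hM⟩ := (isCompact_Icc (a := a) (b := a + 1)).exists_bound_of_continuousOn
    hu.continuousOn
  refine tendsto_integral_of_dominated_convergence
    (fun y => |deriv Real.smoothTransition y| * M) (fun n => ?_) ?_ (fun n => ?_) ?_
  · exact (Real.smoothTransition.continuous_deriv.smul (by fun_prop)).aestronglyMeasurable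
  · exact (Continuous.integrable_of_hasCompactSupport Real.smoothTransition.continuous_deriv
      Real.smoothTransition.hasCompactSupport_deriv).abs.mul_const M
  · refine Eventually.of_forall fun y => ?_
    rw [norm_smul, Real.norm_eq_abs]
    by_cases hy : y < 0 ∨ 1 < y
    · simp [Real.smoothTransition.deriv_eq_zero hy]
    · push Not at hy
      gcongr
      apply hM
      have h1 : ((n : ℝ) + 1)⁻¹ ≤ 1 := inv_le_one_of_one_le₀ (by simp)
      have h0 : 0 ≤ ((n : ℝ) + 1)⁻¹ := by positivity
      constructor <;> nlinarith [mul_nonneg h0 hy.1]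
  · refine Eventually.of_forall fun y => ?_
    refine Tendsto.const_smul ?_ _
    have h : Tendsto (fun n : ℕ => a + ((n : ℝ) + 1)⁻¹ * y) atTop (𝓝 a) := by
      have h1 : Tendsto (fun n : ℕ => ((n : ℝ) + 1)⁻¹) atTop (𝓝 0) := by
        simpa using tendsto_one_div_add_atTop_nhds_zero_nat (𝕜 := ℝ)
      simpa using (h1.mul_const y).const_add a
    exact (hu.tendsto a).comp h

/-- The fundamental theorem of calculus for continuous maps with a weak derivative. -/
theorem HasWeakDeriv.sub_eq_integral {u g : ℝ → Plane} (h : HasWeakDeriv u g)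
    (hu : Continuous u) {a b : ℝ} (hab : a ≤ b) : u b - u a = ∫ t in a..b, g t := by
  set s := Real.smoothTransition with hs
  let N : ℕ → ℝ := fun n => (n : ℝ) + 1
  have hN : ∀ n, 0 < N n := fun n => by simp only [N]; positivity
  -- Smooth test functions tending pointwise to the indicator of `(a, b]`. Their derivatives tend to
  -- the Dirac mass at `a` minus the one at `b`, so the weak derivative identity becomes the claim
  -- in the limit. Each step has width `1 / N n ≤ 1`, whence the common support `[a, b + 1]`.
  let φ : ℕ → ℝ → ℝ := fun n x => s (N n * (x - a)) - s (N n * (x - b))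
  have hφc : ∀ n, ContDiff ℝ ∞ (φ n) := fun n =>
    (Real.smoothTransition.contDiff.comp (by fun_prop)).sub
      (Real.smoothTransition.contDiff.comp (by fun_prop))
  have hφ0 : ∀ n x, x ∉ Set.Icc a (b + 1) → φ n x = 0 := by
    intro n x hx
    rw [Set.mem_Icc, not_and_or, not_le, not_le] at hx
    simp only [φ]
    rcases hx with hx | hx
    · rw [hs, Real.smoothTransition.zero_of_nonpos (by nlinarith [hN n]),
        Real.smoothTransition.zero_of_nonpos (by nlinarith [hN n]), sub_zero]
    · have h1 : 1 ≤ N n := by simp [N]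
      rw [hs, Real.smoothTransition.one_of_one_le (by nlinarith),
        Real.smoothTransition.one_of_one_le (by nlinarith), sub_self]
  have hφs : ∀ n, HasCompactSupport (φ n) := fun n =>
    HasCompactSupport.intro isCompact_Icc (hφ0 n)
  have hstep : ∀ (n : ℕ) (c x : ℝ), HasDerivAt (fun x => s (N n * (x - c)))
      (N n * deriv s (N n * (x - c))) x := by
    intro n c x
    have h1 : HasDerivAt (fun x => N n * (x - c)) (N n) x := by
      simpa using ((hasDerivAt_id x).sub_const c).const_mul (N n)
    rw [mul_comm]
    exact (Real.smoothTransition.differentiable _).hasDerivAt.comp x h1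
  have hint : ∀ (n : ℕ) (c : ℝ),
      Integrable fun x => (N n * deriv s (N n * (x - c))) • u x := by
    intro n c
    refine Continuous.integrable_of_hasCompactSupport ?_ ?_
    · have := Real.smoothTransition.continuous_deriv
      fun_prop
    · refine HasCompactSupport.intro (isCompact_Icc (a := c) (b := c + 1)) fun x hx => ?_
      rw [Set.mem_Icc, not_and_or, not_le, not_le] at hx
      rw [hs, Real.smoothTransition.deriv_eq_zero, mul_zero, zero_smul]
      have h1 : 1 ≤ N n := by simp [N]
      rcases hx with hx | hx
      · left; nlinarith
      · right; nlinarith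
  have hL : Tendsto (fun n => ∫ x, deriv (φ n) x • u x) atTop (𝓝 (u a - u b)) := by
    have h1 : ∀ n, ∫ x, deriv (φ n) x • u x = (∫ x, (N n * deriv s (N n * (x - a))) • u x) -
        ∫ x, (N n * deriv s (N n * (x - b))) • u x := by
      intro n
      rw [← integral_sub (hint n a) (hint n b)]
      congr 1 with x
      rw [((hstep n a x).fun_sub (hstep n b x)).deriv, sub_smul]
    simp only [h1]
    exact (tendsto_integral_deriv_smoothTransition_smul hu a).sub
      (tendsto_integral_deriv_smoothTransition_smul hu b)
  have hR : Tendsto (fun n => ∫ x, φ n x • g x) atTop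
      (𝓝 (∫ x, (Set.Ioc a b).indicator g x)) := by
    refine tendsto_integral_of_dominated_convergence
      (fun x => (Set.Icc a (b + 1)).indicator (fun x => ‖g x‖) x) (fun n => ?_) ?_ (fun n => ?_) ?_
    · exact (hφc n).continuous.aestronglyMeasurable.smul
        h.locallyIntegrable_deriv.aestronglyMeasurable
    · rw [integrable_indicator_iff measurableSet_Icc]
      exact (h.locallyIntegrable_deriv.integrableOn_isCompact isCompact_Icc).norm
    · refine Eventually.of_forall fun x => ?_
      by_cases hx : x ∈ Set.Icc a (b + 1)
      · rw [Set.indicator_of_mem hx, norm_smul, Real.norm_eq_abs]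
        refine mul_le_of_le_one_left (norm_nonneg _) ?_
        simp only [φ, abs_le]
        have h1 := Real.smoothTransition.nonneg (N n * (x - a))
        have h2 := Real.smoothTransition.nonneg (N n * (x - b))
        have h3 := Real.smoothTransition.le_one (N n * (x - a))
        have h4 := Real.smoothTransition.le_one (N n * (x - b))
        constructor <;> simp only [hs] <;> linarith
      · rw [hφ0 n x hx, Set.indicator_of_notMem hx, zero_smul, norm_zero]
    · refine Eventually.of_forall fun x => ?_
      have hstep1 : ∀ c, c < x → ∀ᶠ n in atTop, s (N n * (x - c)) = 1 := by
        intro c hc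
        have : Tendsto (fun n => N n * (x - c)) atTop atTop :=
          (tendsto_atTop_add_const_right _ _ tendsto_natCast_atTop_atTop).atTop_mul_const
            (sub_pos.2 hc)
        filter_upwards [this.eventually_ge_atTop 1] with n hn
        exact Real.smoothTransition.one_of_one_le hn
      -- The case `x = c` is included because `s 0 = 0`; this is why the limit is the half-open
      -- `Ioc` at every point.
      have hstep0 : ∀ c, x ≤ c → ∀ n, s (N n * (x - c)) = 0 := fun c hc n =>
        Real.smoothTransition.zero_of_nonpos (by nlinarith [hN n])
      refine tendsto_const_nhds.congr' ?_
      rcases le_or_gt x a with hxa | hxa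
      · refine Eventually.of_forall fun n => ?_
        rw [Set.indicator_of_notMem (by simp; intro; linarith)]
        simp only [φ]
        rw [hstep0 a hxa, hstep0 b (hxa.trans hab)]
        simp
      rcases le_or_gt x b with hxb | hxb
      · filter_upwards [hstep1 a hxa] with n hn
        rw [Set.indicator_of_mem (Set.mem_Ioc.2 ⟨hxa, hxb⟩)]
        simp only [φ]
        rw [hn, hstep0 b hxb]
        simp
      · filter_upwards [hstep1 a hxa, hstep1 b hxb] with n hn hn'
        rw [Set.indicator_of_notMem (by simp; intro; linarith)]
        simp only [φ]
        rw [hn, hn']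
        simp
  rw [integral_indicator measurableSet_Ioc, ← intervalIntegral.integral_of_le hab] at hR
  have hLR : ∀ n, ∫ x, deriv (φ n) x • u x = -∫ x, φ n x • g x := fun n =>
    h.integral_eq (φ n) (hφc n) (hφs n)
  simp only [hLR] at hL
  have := tendsto_nhds_unique hL hR.neg
  rw [← neg_sub, this, neg_neg]

theorem HasWeakDeriv.ae_hasDerivAt {u g : ℝ → Plane} (h : HasWeakDeriv u g)
    (hu : Continuous u) : ∀ᵐ t, HasDerivAt u (g t) t := by
  filter_upwards [LocallyIntegrable.ae_hasDerivAt_integral h.locallyIntegrable_deriv] with t ht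
  have h1 := (ht 0).const_add (u 0)
  refine h1.congr_of_eventuallyEq (Eventually.of_forall fun x => ?_)
  rcases le_total 0 x with hx | hx
  · simp [← h.sub_eq_integral hu hx]
  · simp only
    rw [intervalIntegral.integral_symm, ← h.sub_eq_integral hu hx]; simp

theorem hasWeakDeriv_weakDeriv {u : ℝ → Plane} (hu : ∃ g, HasWeakDeriv u g) :
    HasWeakDeriv u (weakDeriv u) := by
  rw [weakDeriv, dif_pos hu]; exact hu.choose_spec

theorem ae_hasDerivAt_weakDeriv {u : ℝ → Plane} (hu : u ∈ sobolevLoops) :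
    ∀ᵐ t, HasDerivAt u (weakDeriv u t) t :=
  (hasWeakDeriv_weakDeriv hu.2.2).ae_hasDerivAt hu.1

theorem weakDeriv_ae_eq_deriv {u : ℝ → Plane} (hu : u ∈ sobolevLoops) :
    weakDeriv u =ᵐ[volume] deriv u := by
  filter_upwards [ae_hasDerivAt_weakDeriv hu] with t ht using ht.deriv.symm

theorem locallyIntegrable_deriv_of_mem_sobolevLoops {u : ℝ → Plane} (hu : u ∈ sobolevLoops) :
    LocallyIntegrable (deriv u) volume :=
  (hasWeakDeriv_weakDeriv hu.2.2).locallyIntegrable_deriv.congr (weakDeriv_ae_eq_deriv hu)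

theorem intervalIntegrable_deriv_of_mem_sobolevLoops {u : ℝ → Plane} (hu : u ∈ sobolevLoops)
    (a b : ℝ) : IntervalIntegrable (deriv u) volume a b :=
  ((locallyIntegrable_deriv_of_mem_sobolevLoops hu).integrableOn_isCompact
    isCompact_uIcc).intervalIntegrable

theorem sub_eq_integral_deriv_of_mem_sobolevLoops {u : ℝ → Plane} (hu : u ∈ sobolevLoops)
    {a b : ℝ} (hab : a ≤ b) : u b - u a = ∫ t in a..b, deriv u t := by
  rw [(hasWeakDeriv_weakDeriv hu.2.2).sub_eq_integral hu.1 hab]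
  refine intervalIntegral.integral_congr_ae ?_
  filter_upwards [weakDeriv_ae_eq_deriv hu] with t ht _ using ht

theorem ae_hasDerivAt_of_mem_sobolevLoops {u : ℝ → Plane} (hu : u ∈ sobolevLoops) :
    ∀ᵐ t, HasDerivAt u (deriv u t) t := by
  filter_upwards [ae_hasDerivAt_weakDeriv hu] with t ht using ht.differentiableAt.hasDerivAt

theorem energy_eq_integral_deriv (F : Plane → Plane → ℝ) {u : ℝ → Plane}
    (hu : u ∈ sobolevLoops) : energy F u = ∫ t in (0 : ℝ)..1, F (u t) (deriv u t) := by
  refine intervalIntegral.integral_congr_ae ?_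
  filter_upwards [weakDeriv_ae_eq_deriv hu] with t ht _
  rw [ht]

theorem signedArea_eq_integral_deriv {u : ℝ → Plane} (hu : u ∈ sobolevLoops) :
    signedArea u = (1 / 2) * ∫ t in (0 : ℝ)..1, inner ℝ (u t) (rot (deriv u t)) := by
  rw [signedArea]
  congr 1
  refine intervalIntegral.integral_congr_ae ?_
  filter_upwards [weakDeriv_ae_eq_deriv hu] with t ht _
  rw [ht]

/-- Coordinate by coordinate, this is integration by parts for a Lipschitz function against a
compactly supported Lipschitz one, combined with differentiability almost everywhere. -/
theorem LipschitzWith.hasWeakDeriv {u : ℝ → Plane} {K : NNReal} (hu : LipschitzWith K u) :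
    HasWeakDeriv u (deriv u) := by
  have hloc : LocallyIntegrable (deriv u) volume := by
    refine (locallyIntegrable_const (K : ℝ)).mono
      (measurable_deriv u).aestronglyMeasurable (Eventually.of_forall fun t => ?_)
    simpa using norm_deriv_le_of_lipschitz hu
  refine ⟨hu.continuous.locallyIntegrable, hloc, fun φ hφ hφs => ?_⟩
  obtain ⟨D, hD⟩ := (hφ.of_le (by simp : (1 : WithTop ℕ∞) ≤ ∞)).lipschitzWith_of_hasCompactSupport
    hφs one_ne_zero
  have hφ1 : Integrable fun t => deriv φ t • u t :=
    Continuous.integrable_of_hasCompactSupport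
      ((hφ.continuous_deriv (by simp)).smul hu.continuous) hφs.deriv.smul_right
  have hφ2 : Integrable fun t => φ t • deriv u t :=
    hloc.integrable_smul_left_of_hasCompactSupport hφ.continuous hφs
  ext i
  have e1 := (EuclideanSpace.proj (𝕜 := ℝ) i : Plane →L[ℝ] ℝ).integral_comp_comm hφ1
  have e2 := (EuclideanSpace.proj (𝕜 := ℝ) i : Plane →L[ℝ] ℝ).integral_comp_comm hφ2
  simp only [PiLp.proj_apply, PiLp.smul_apply, smul_eq_mul, PiLp.neg_apply] at e1 e2 ⊢
  rw [← e1, ← e2]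
  have hui : LipschitzWith K fun t => u t i := by
    refine LipschitzWith.of_dist_le_mul fun x y => ?_
    refine le_trans ?_ (hu.dist_le_mul x y)
    rw [dist_eq_norm, dist_eq_norm]
    exact PiLp.norm_apply_le (u x - u y) i
  -- The derivative moves onto `φ` in the opposite direction `-1`, which produces the minus sign.
  have key := integral_lineDeriv_mul_eq (μ := volume) hui hD hφs 1
  have h1 : ∀ᵐ t, lineDeriv ℝ (fun t => u t i) t 1 = deriv u t i := by
    filter_upwards [hu.ae_differentiableAt_real] with t ht
    have := ((EuclideanSpace.proj (𝕜 := ℝ) i : Plane →L[ℝ] ℝ).hasFDerivAt.comp_hasDerivAt t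
      ht.hasDerivAt)
    have h3 : HasDerivAt (fun t => u t i) (deriv u t i) t := this
    simpa using (h3.hasFDerivAt.hasLineDerivAt 1).lineDeriv
  have h2 : ∀ t, lineDeriv ℝ φ t (-1) = - deriv φ t := by
    intro t
    have h3 : HasDerivAt φ (deriv φ t) t := (hφ.differentiable (by simp) t).hasDerivAt
    simpa using (h3.hasFDerivAt.hasLineDerivAt (-1)).lineDeriv
  have e3 : ∫ t, φ t * deriv u t i = ∫ t, lineDeriv ℝ (fun t => u t i) t 1 * φ t := by
    refine integral_congr_ae ?_
    filter_upwards [h1] with t ht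
    rw [ht, mul_comm]
  rw [e3, key]
  simp only [h2, neg_mul, integral_neg, neg_neg]

theorem LipschitzWith.mem_sobolevLoops {u : ℝ → Plane} {K : NNReal} (hu : LipschitzWith K u)
    (hp : Function.Periodic u 1) : u ∈ sobolevLoops :=
  ⟨hu.continuous, hp, _, hu.hasWeakDeriv⟩

theorem Function.Periodic.deriv_eq {u : ℝ → Plane} {c : ℝ} (hu : Function.Periodic u c) :
    Function.Periodic (deriv u) c := by
  intro t
  rw [← deriv_comp_add_const u c t]
  congr 1
  ext1 x
  exact hu x

/-! ### Lipschitz reparametrization -/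

/-- Reparametrization by (perturbed) arc length: a loop of class `W^{1,1}` has a Lipschitz
reparametrization, which leaves the integrals of all one-homogeneous Lagrangians unchanged. -/
theorem exists_lipschitz_reparametrization {u : ℝ → Plane} (hu : u ∈ sobolevLoops) :
    ∃ v : ℝ → Plane, LipschitzWith (∫ t in (0 : ℝ)..1, (‖deriv u t‖ + 1)).toNNReal v ∧
      Function.Periodic v 1 ∧
      ∀ H : Plane → Plane → ℝ, (∀ p q : Plane, ∀ c : ℝ, 0 < c → H p (c • q) = c * H p q) →
        ∫ t in (0 : ℝ)..1, H (v t) (deriv v t) = ∫ t in (0 : ℝ)..1, H (u t) (deriv u t) := by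
  have gi := intervalIntegrable_deriv_of_mem_sobolevLoops hu
  -- The added `1` makes `σ` strictly increasing with nonvanishing derivative almost everywhere,
  -- even where the loop is stationary; plain arc length would not be invertible there.
  set w : ℝ → ℝ := fun t => ‖deriv u t‖ + 1 with hw
  have hwpos : ∀ t, 0 < w t := fun t => by positivity
  have wi : ∀ a b, IntervalIntegrable w volume a b := fun a b =>
    (gi a b).norm.add intervalIntegrable_const
  have wloc : LocallyIntegrable w volume :=
    LocallyIntegrable.add (fun t => (locallyIntegrable_deriv_of_mem_sobolevLoops hu t).norm)
      (locallyIntegrable_const 1)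
  set c : ℝ := ∫ t in (0 : ℝ)..1, w t with hc
  have wge : ∀ a b : ℝ, a ≤ b → b - a ≤ ∫ t in a..b, w t := by
    intro a b hab
    have : ∫ _ in a..b, (1 : ℝ) = b - a := by simp
    rw [← this]
    exact intervalIntegral.integral_mono_on hab intervalIntegrable_const (wi a b)
      fun t _ => by simp [hw]
  have hcpos : 0 < c := lt_of_lt_of_le (by norm_num) (wge 0 1 zero_le_one)
  set σ : ℝ → ℝ := fun t => c⁻¹ * ∫ s in (0 : ℝ)..t, w s with hσ
  have σsub : ∀ a b, σ b - σ a = c⁻¹ * ∫ t in a..b, w t := by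
    intro a b
    simp only [hσ]
    rw [← mul_sub, intervalIntegral.integral_interval_sub_left (wi _ _) (wi _ _)]
  have σ0 : σ 0 = 0 := by simp [hσ]
  have σ1 : σ 1 = 1 := by simp only [hσ]; exact inv_mul_cancel₀ hcpos.ne'
  have σgrow : ∀ a b : ℝ, a ≤ b → c⁻¹ * (b - a) ≤ σ b - σ a := by
    intro a b hab
    rw [σsub]
    exact mul_le_mul_of_nonneg_left (wge a b hab) (inv_pos.2 hcpos).le
  have σmono : StrictMono σ := by
    intro a b hab
    have h1 := σgrow a b hab.le
    have h2 : 0 < c⁻¹ * (b - a) := mul_pos (inv_pos.2 hcpos) (sub_pos.2 hab)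
    linarith
  have σcont : Continuous σ :=
    (intervalIntegral.continuous_primitive wi 0).const_mul _
  have σsurj : Function.Surjective σ := by
    refine σcont.surjective ?_ ?_
    · refine tendsto_atTop_mono' atTop ?_ (tendsto_id.const_mul_atTop (inv_pos.2 hcpos))
      filter_upwards [eventually_ge_atTop 0] with t ht
      simpa [σ0] using σgrow 0 t ht
    · refine tendsto_atBot_mono' atBot ?_ (tendsto_id.const_mul_atBot (inv_pos.2 hcpos))
      filter_upwards [eventually_le_atBot 0] with t ht
      have := σgrow t 0 ht
      rw [σ0] at this
      simp only [id]
      linarith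
  have wper : Function.Periodic w 1 := fun t => by simp only [hw, hu.2.1.deriv_eq t]
  have σper : ∀ t, σ (t + 1) = σ t + 1 := by
    intro t
    have h1 := σsub t (t + 1)
    rw [wper.intervalIntegral_add_eq t 0, zero_add, ← hc, inv_mul_cancel₀ hcpos.ne'] at h1
    linarith
  let e : ℝ ≃ₜ ℝ := (σmono.orderIsoOfSurjective σ σsurj).toHomeomorph
  have eσ : ∀ t, e.symm (σ t) = t := fun t => e.symm_apply_apply t
  have σe : ∀ t, σ (e.symm t) = t := fun t => e.apply_symm_apply t
  set v : ℝ → Plane := fun s => u (e.symm s) with hv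
  have hub : ∀ a b : ℝ, a ≤ b → ‖u b - u a‖ ≤ c * (σ b - σ a) := by
    intro a b hab
    rw [σsub, mul_inv_cancel_left₀ hcpos.ne', sub_eq_integral_deriv_of_mem_sobolevLoops hu hab]
    refine (intervalIntegral.norm_integral_le_integral_norm hab).trans ?_
    exact intervalIntegral.integral_mono_on hab (gi a b).norm (wi a b) fun t _ => by simp [hw]
  refine ⟨v, ?_, ?_, ?_⟩
  · refine LipschitzWith.of_dist_le_mul fun x y => ?_
    rw [Real.coe_toNNReal _ hcpos.le]
    rcases le_total (e.symm x) (e.symm y) with hxy | hxy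
    · have h1 := hub _ _ hxy
      rw [σe, σe] at h1
      rw [dist_comm, dist_comm x, dist_eq_norm, Real.dist_eq]
      exact h1.trans (mul_le_mul_of_nonneg_left (le_abs_self _) hcpos.le)
    · have h1 := hub _ _ hxy
      rw [σe, σe] at h1
      rw [dist_eq_norm, Real.dist_eq]
      exact h1.trans (mul_le_mul_of_nonneg_left (le_abs_self _) hcpos.le)
  · intro s
    have h1 : e.symm (s + 1) = e.symm s + 1 := by
      rw [← eσ (e.symm s + 1), σper, σe]
    simp only [hv]
    rw [h1, hu.2.1]
  · intro H hH
    have hae : ∀ᵐ t, HasDerivAt u (deriv u t) t ∧ HasDerivAt σ (c⁻¹ * w t) t := by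
      filter_upwards [ae_hasDerivAt_of_mem_sobolevLoops hu,
        LocallyIntegrable.ae_hasDerivAt_integral wloc] with t h1 h2
      exact ⟨h1, (h2 0).const_mul _⟩
    -- `H` is not assumed measurable, so everything is done on a measurable set `T` of full measure
    -- where both derivatives exist; the change of variables on it holds for an arbitrary integrand.
    obtain ⟨N, hN, hNm, hN0⟩ := exists_measurable_superset_of_null (ae_iff.1 hae)
    have hNae : ∀ᵐ t, t ∉ N := measure_eq_zero_iff_ae_notMem.1 hN0
    set T : Set ℝ := Set.Ioc 0 1 ∩ Nᶜ with hT
    have hTm : MeasurableSet T := measurableSet_Ioc.inter hNm.compl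
    have hTae : T =ᵐ[volume] Set.Ioc (0 : ℝ) 1 := by
      filter_upwards [hNae] with t ht
      exact propext ⟨fun h => h.1, fun h => ⟨h, ht⟩⟩
    have hTd : ∀ t ∈ T, HasDerivAt u (deriv u t) t ∧ HasDerivAt σ (c⁻¹ * w t) t := by
      intro t ht
      by_contra hcon
      exact ht.2 (hN hcon)
    have hpos : ∀ t, 0 < c⁻¹ * w t := fun t => mul_pos (inv_pos.2 hcpos) (hwpos t)
    have hchange := fun G : ℝ → ℝ => integral_image_eq_integral_abs_deriv_smul hTm
      (fun t ht => (hTd t ht).2.hasDerivWithinAt) σmono.injective.injOn G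
    have himm : MeasurableSet (σ '' T) := e.measurableEmbedding.measurableSet_image.2 hTm
    have hsub : σ '' T ⊆ Set.Ioc 0 1 := by
      rintro _ ⟨t, ht, rfl⟩
      exact ⟨σ0 ▸ σmono ht.1.1, σ1 ▸ σmono.monotone ht.1.2⟩
    -- The image of `T` has measure `∫ σ' = 1`, so it fills `(0, 1]` up to a null set. This excludes
    -- that `σ` sends the discarded null set to a set of positive measure.
    have hvol : volume.real (σ '' T) = 1 := by
      have h1 := hchange fun _ => 1
      simp only [smul_eq_mul, mul_one, integral_const, measureReal_restrict_apply_univ] at h1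
      rw [h1, setIntegral_congr_set hTae, ← intervalIntegral.integral_of_le zero_le_one]
      simp only [abs_of_pos (hpos _)]
      rw [intervalIntegral.integral_const_mul, ← hc, inv_mul_cancel₀ hcpos.ne']
    have himae : σ '' T =ᵐ[volume] Set.Ioc (0 : ℝ) 1 := by
      refine ae_eq_of_subset_of_measure_ge hsub ?_ himm.nullMeasurableSet (by simp)
      have hfin : volume (σ '' T) ≠ ⊤ :=
        ne_top_of_le_ne_top (by simp) (measure_mono hsub)
      rw [← ENNReal.ofReal_toReal hfin]
      change _ ≤ ENNReal.ofReal (volume.real (σ '' T))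
      rw [hvol]; simp
    have hvd : ∀ t ∈ T, deriv v (σ t) = (c⁻¹ * w t)⁻¹ • deriv u t := by
      intro t ht
      have h1 : HasDerivAt e.symm (c⁻¹ * w t)⁻¹ (σ t) := by
        refine HasDerivAt.of_local_left_inverse (f := σ) e.symm.continuous.continuousAt ?_
          (hpos t).ne' (Eventually.of_forall σe)
        rw [eσ]
        exact (hTd t ht).2
      have h2 : HasDerivAt u (deriv u t) (e.symm (σ t)) := by
        rw [eσ]; exact (hTd t ht).1
      exact (h2.scomp (σ t) h1).deriv
    rw [intervalIntegral.integral_of_le zero_le_one, intervalIntegral.integral_of_le zero_le_one,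
      ← setIntegral_congr_set himae, ← setIntegral_congr_set hTae, hchange]
    refine setIntegral_congr_fun hTm fun t ht => ?_
    have hvt : v (σ t) = u t := congrArg u (eσ t)
    simp only [hvd t ht, hvt]
    rw [hH _ _ _ (inv_pos.2 (hpos t)), abs_of_pos (hpos t), smul_eq_mul,
      mul_inv_cancel_left₀ (hpos t).ne']

/-! ### Lower semicontinuity by difference quotients -/

/-- Steklov averages of a periodic function have the same mean as the function. -/
theorem Function.Periodic.integral_average_eq {f : ℝ → ℝ} (hp : Function.Periodic f 1)
    (hf : ∀ a b, IntervalIntegrable f volume a b) {h : ℝ} (hh : 0 < h) :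
    ∫ t in (0 : ℝ)..1, h⁻¹ * ∫ s in t..t + h, f s = ∫ t in (0 : ℝ)..1, f t := by
  set P : ℝ → ℝ := fun t => ∫ s in (0 : ℝ)..t, f s with hP
  have hPc : Continuous P := intervalIntegral.continuous_primitive hf 0
  have Pi : ∀ a b, IntervalIntegrable P volume a b := fun a b => hPc.intervalIntegrable a b
  have h1 : ∀ t, ∫ s in t..t + h, f s = P (t + h) - P t := fun t =>
    (intervalIntegral.integral_interval_sub_left (hf _ _) (hf _ _)).symm
  have h2 : ∀ t, P (t + 1) - P t = ∫ s in (0 : ℝ)..1, f s := by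
    intro t
    simp only [hP]
    rw [intervalIntegral.integral_interval_sub_left (hf _ _) (hf _ _),
      hp.intervalIntegral_add_eq t 0, zero_add]
  have hPc' : ∀ c, Continuous fun t => P (t + c) := fun c => by fun_prop
  -- Splitting the integral of `P` over `[0, 1 + h]` at `h` and at `1` turns the left side into `∫₀ʰ
  -- (P (t + 1) - P t)`, whose integrand is the constant mean of `f`.
  have key : ∫ t in (0 : ℝ)..1, (P (t + h) - P t) = h * ∫ s in (0 : ℝ)..1, f s := by
    rw [intervalIntegral.integral_sub ((hPc' h).intervalIntegrable _ _) (Pi _ _),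
      intervalIntegral.integral_comp_add_right, zero_add]
    have e1 := intervalIntegral.integral_add_adjacent_intervals (Pi 0 h) (Pi h (1 + h))
    have e2 := intervalIntegral.integral_add_adjacent_intervals (Pi 0 1) (Pi 1 (1 + h))
    have e3 : ∫ t in (1 : ℝ)..1 + h, P t = ∫ t in (0 : ℝ)..h, P (t + 1) := by
      rw [intervalIntegral.integral_comp_add_right, zero_add, add_comm]
    have e4 : ∫ t in (0 : ℝ)..h, (P (t + 1) - P t) = h * ∫ s in (0 : ℝ)..1, f s := by
      simp only [h2]; simp
    rw [intervalIntegral.integral_sub ((hPc' 1).intervalIntegrable _ _) (Pi _ _)] at e4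
    linarith
  simp only [h1]
  rw [intervalIntegral.integral_const_mul, key, inv_mul_cancel_left₀ hh.ne']

theorem LipschitzWith.intervalIntegrable_lagrangian {H : Plane → Plane → ℝ}
    (hH : Continuous fun x : Plane × Plane => H x.1 x.2) {w : ℝ → Plane} {K : NNReal}
    (hw : LipschitzWith K w) (a b : ℝ) :
    IntervalIntegrable (fun t => H (w t) (deriv w t)) volume a b := by
  have hcomp : IsCompact ((w '' Set.uIcc a b) ×ˢ Metric.closedBall (0 : Plane) K) :=
    (isCompact_uIcc.image hw.continuous).prod (isCompact_closedBall _ _)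
  obtain ⟨M, hM⟩ := hcomp.exists_bound_of_continuousOn hH.continuousOn
  refine (intervalIntegrable_const (c := M)).mono_fun
    (hH.measurable.comp (hw.continuous.measurable.prodMk
      (measurable_deriv w))).aestronglyMeasurable ?_
  refine (ae_restrict_iff' measurableSet_uIoc).2 (Eventually.of_forall fun t ht => ?_)
  refine (hM (w t, deriv w t) ⟨⟨t, Set.uIoc_subset_uIcc ht, rfl⟩, ?_⟩).trans (le_abs_self M)
  simpa using norm_deriv_le_of_lipschitz hw

/-- A difference quotient is an average of the derivative, so Jensen's inequality applies with the
position frozen at `w t`. Unfreezing it costs `ε`, and averaging over `[t, t + h]` preserves the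
integral over a period. -/
theorem integral_lagrangian_slope_le {H : Plane → Plane → ℝ}
    (hH : Continuous fun x : Plane × Plane => H x.1 x.2)
    (hconv : ∀ p, ConvexOn ℝ Set.univ (H p)) {w : ℝ → Plane} {K : NNReal}
    (hw : LipschitzWith K w) (hp : Function.Periodic w 1) {h ε : ℝ} (hh : 0 < h)
    (hε : ∀ s t : ℝ, ‖w s - w t‖ ≤ K * h → ∀ q : Plane, ‖q‖ ≤ K →
      H (w t) q ≤ H (w s) q + ε) :
    ∫ t in (0 : ℝ)..1, H (w t) (h⁻¹ • (w (t + h) - w t)) ≤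
      (∫ t in (0 : ℝ)..1, H (w t) (deriv w t)) + ε := by
  have hcont : ∀ p, Continuous (H p) := fun p => hH.comp (by fun_prop : Continuous fun q => (p, q))
  set f : ℝ → ℝ := fun t => H (w t) (deriv w t) with hf
  have fi : ∀ a b, IntervalIntegrable f volume a b :=
    hw.intervalIntegrable_lagrangian hH
  have fp : Function.Periodic f 1 := fun t => by simp only [hf, hp t, hp.deriv_eq t]
  have di := intervalIntegrable_deriv_of_mem_sobolevLoops (hw.mem_sobolevLoops hp)
  have hpt : ∀ t, H (w t) (h⁻¹ • (w (t + h) - w t)) ≤ h⁻¹ * (∫ s in t..t + h, f s) + ε := by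
    intro t
    have hle : t ≤ t + h := by linarith
    have hHi : IntervalIntegrable (fun s => H (w t) (deriv w s)) volume t (t + h) :=
      hw.intervalIntegrable_lagrangian (H := fun _ q => H (w t) q)
        ((hcont _).comp continuous_snd) t (t + h)
    have hJ := (hconv (w t)).map_set_average_le (μ := volume) (t := Set.Ioc t (t + h))
      (f := deriv w) (hcont _).continuousOn isClosed_univ
      (by simp [hh]) (by simp) (by simp)
      ((intervalIntegrable_iff_integrableOn_Ioc_of_le hle).1 (di t (t + h)))
      ((intervalIntegrable_iff_integrableOn_Ioc_of_le hle).1 hHi)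
    rw [setAverage_eq, setAverage_eq, Real.volume_real_Ioc_of_le hle, add_sub_cancel_left,
      ← intervalIntegral.integral_of_le hle, ← intervalIntegral.integral_of_le hle,
      ← sub_eq_integral_deriv_of_mem_sobolevLoops (hw.mem_sobolevLoops hp) hle,
      smul_eq_mul] at hJ
    refine hJ.trans ?_
    have hm : ∫ s in t..t + h, H (w t) (deriv w s) ≤ ∫ s in t..t + h, (f s + ε) := by
      refine intervalIntegral.integral_mono_on hle hHi
        ((fi _ _).add intervalIntegrable_const) fun s hs => ?_
      refine hε s t ?_ _ (norm_deriv_le_of_lipschitz hw)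
      rw [← dist_eq_norm]
      refine (hw.dist_le_mul s t).trans (mul_le_mul_of_nonneg_left ?_ K.2)
      rw [Real.dist_eq, abs_of_nonneg (by linarith [hs.1])]
      linarith [hs.2]
    rw [intervalIntegral.integral_add (fi _ _) intervalIntegrable_const] at hm
    simp only [intervalIntegral.integral_const, add_sub_cancel_left, smul_eq_mul] at hm
    calc _ ≤ h⁻¹ * ((∫ s in t..t + h, f s) + h * ε) :=
          mul_le_mul_of_nonneg_left hm (inv_pos.2 hh).le
      _ = _ := by rw [mul_add, inv_mul_cancel_left₀ hh.ne']
  have hPc : Continuous fun t => h⁻¹ * ∫ s in t..t + h, f s := by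
    have h1 : Continuous fun t => ∫ s in (0 : ℝ)..t, f s :=
      intervalIntegral.continuous_primitive fi 0
    have h2 : (fun t => h⁻¹ * ∫ s in t..t + h, f s) = fun t =>
        h⁻¹ * ((∫ s in (0 : ℝ)..t + h, f s) - ∫ s in (0 : ℝ)..t, f s) := by
      ext t
      rw [intervalIntegral.integral_interval_sub_left (fi _ _) (fi _ _)]
    rw [h2]
    fun_prop
  have hwc := hw.continuous
  have hL : Continuous fun t => H (w t) (h⁻¹ • (w (t + h) - w t)) :=
    hH.comp (by fun_prop : Continuous fun t => (w t, h⁻¹ • (w (t + h) - w t)))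
  refine (intervalIntegral.integral_mono_on zero_le_one (hL.intervalIntegrable _ _)
    ((hPc.add continuous_const).intervalIntegrable _ _) fun t _ => hpt t).trans_eq ?_
  simp only [Pi.add_apply]
  rw [intervalIntegral.integral_add (hPc.intervalIntegrable _ _) intervalIntegrable_const,
    fp.integral_average_eq fi hh]
  simp

/-- Lower semicontinuity, along convergent equi-Lipschitz sequences of loops, of the
integral of a Lagrangian that is convex in the velocity. -/
theorem integral_lagrangian_le_of_tendsto {H : Plane → Plane → ℝ}
    (hH : Continuous fun x : Plane × Plane => H x.1 x.2)
    (hconv : ∀ p, ConvexOn ℝ Set.univ (H p)) {v : ℕ → ℝ → Plane} {w : ℝ → Plane} {K : NNReal}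
    (hv : ∀ n, LipschitzWith K (v n)) (hp : ∀ n, Function.Periodic (v n) 1)
    (hw : LipschitzWith K w) {R : ℝ} (hR : ∀ n t, ‖v n t‖ ≤ R)
    (hlim : ∀ t, Tendsto (fun n => v n t) atTop (𝓝 (w t))) {C : ℝ}
    (hC : Tendsto (fun n => ∫ t in (0 : ℝ)..1, H (v n t) (deriv (v n) t)) atTop (𝓝 C)) :
    ∫ t in (0 : ℝ)..1, H (w t) (deriv w t) ≤ C := by
  have hRw : ∀ t, ‖w t‖ ≤ R := fun t => le_of_tendsto (hlim t).norm (Eventually.of_forall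
    fun n => hR n t)
  have hcomp : IsCompact (Metric.closedBall (0 : Plane) R ×ˢ Metric.closedBall (0 : Plane) K) :=
    (isCompact_closedBall _ _).prod (isCompact_closedBall _ _)
  obtain ⟨M, hM⟩ := hcomp.exists_bound_of_continuousOn hH.continuousOn
  have hslope : ∀ {z : ℝ → Plane}, LipschitzWith K z → ∀ {h : ℝ}, 0 < h → ∀ t,
      ‖h⁻¹ • (z (t + h) - z t)‖ ≤ K := by
    intro z hz h hh t
    have h1 := hz.dist_le_mul (t + h) t
    rw [dist_eq_norm, Real.dist_eq, add_sub_cancel_left, abs_of_pos hh] at h1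
    rw [norm_smul, Real.norm_eq_abs, abs_of_pos (inv_pos.2 hh)]
    calc h⁻¹ * ‖z (t + h) - z t‖ ≤ h⁻¹ * (K * h) :=
          mul_le_mul_of_nonneg_left h1 (inv_pos.2 hh).le
      _ = K := by field_simp
  have hcontslope : ∀ {z : ℝ → Plane}, LipschitzWith K z → ∀ h : ℝ,
      Continuous fun t => H (z t) (h⁻¹ • (z (t + h) - z t)) := by
    intro z hz h
    have := hz.continuous
    exact hH.comp (by fun_prop : Continuous fun t => (z t, h⁻¹ • (z (t + h) - z t)))
  refine le_of_forall_pos_le_add fun ε hε => ?_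
  obtain ⟨δ, hδ, hδ'⟩ := Metric.uniformContinuousOn_iff.1
    (hcomp.uniformContinuousOn_of_continuous hH.continuousOn) ε hε
  -- The limit `n → ∞` is taken first, at fixed `h`: difference quotients converge pointwise
  -- although the derivatives need not. Only then does `h → 0` recover the derivative of `w`.
  have hsmall : ∀ h : ℝ, 0 < h → K * h < δ →
      ∫ t in (0 : ℝ)..1, H (w t) (h⁻¹ • (w (t + h) - w t)) ≤ C + ε := by
    intro h hh hKh
    have hn : ∀ n, ∫ t in (0 : ℝ)..1, H (v n t) (h⁻¹ • (v n (t + h) - v n t)) ≤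
        (∫ t in (0 : ℝ)..1, H (v n t) (deriv (v n) t)) + ε := by
      intro n
      refine integral_lagrangian_slope_le hH hconv (hv n) (hp n) hh fun s t hst q hq => ?_
      have h1 := hδ' (v n t, q) ⟨by simpa using hR n t, by simpa using hq⟩
        (v n s, q) ⟨by simpa using hR n s, by simpa using hq⟩ (by
          rw [Prod.dist_eq]
          simp only [dist_self]
          rw [max_eq_left dist_nonneg, dist_comm, dist_eq_norm]
          linarith)
      rw [Real.dist_eq] at h1
      linarith [(abs_lt.1 h1).2]
    refine le_of_tendsto_of_tendsto' ?_ (hC.add_const ε) hn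
    refine intervalIntegral.tendsto_integral_filter_of_dominated_convergence (fun _ => M)
      (Eventually.of_forall fun n => (hcontslope (hv n) h).aestronglyMeasurable)
      (Eventually.of_forall fun n => Eventually.of_forall fun t _ =>
        hM (v n t, h⁻¹ • (v n (t + h) - v n t))
          ⟨by simpa using hR n t, by simpa using hslope (hv n) hh t⟩)
      intervalIntegrable_const (Eventually.of_forall fun t _ => ?_)
    exact (hH.tendsto (w t, h⁻¹ • (w (t + h) - w t))).comp
      ((hlim t).prodMk_nhds (((hlim (t + h)).sub (hlim t)).const_smul h⁻¹))
  have hlim0 : Tendsto (fun h : ℝ => ∫ t in (0 : ℝ)..1, H (w t) (h⁻¹ • (w (t + h) - w t)))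
      (𝓝[>] 0) (𝓝 (∫ t in (0 : ℝ)..1, H (w t) (deriv w t))) := by
    refine intervalIntegral.tendsto_integral_filter_of_dominated_convergence (fun _ => M)
      (Eventually.of_forall fun h => (hcontslope hw h).aestronglyMeasurable) ?_
      intervalIntegrable_const ?_
    · filter_upwards [self_mem_nhdsWithin] with h hh
      exact Eventually.of_forall fun t _ => hM (w t, h⁻¹ • (w (t + h) - w t))
          ⟨by simpa using hRw t, by simpa using hslope hw hh t⟩
    · filter_upwards [hw.ae_differentiableAt_real] with t ht _
      have h1 : Tendsto (fun h : ℝ => h⁻¹ • (w (t + h) - w t)) (𝓝[>] 0) (𝓝 (deriv w t)) :=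
        (hasDerivAt_iff_tendsto_slope_zero.1 ht.hasDerivAt).mono_left
          (nhdsWithin_mono _ fun x hx => ne_of_gt hx)
      exact (hH.tendsto (w t, deriv w t)).comp (tendsto_const_nhds.prodMk_nhds h1)
  refine le_of_tendsto hlim0 ?_
  have h2 : ∀ᶠ h : ℝ in 𝓝[>] 0, K * h < δ := by
    have h3 : Tendsto (fun h : ℝ => K * h) (𝓝 0) (𝓝 0) := by
      simpa using (tendsto_id (α := ℝ) (x := 𝓝 0)).const_mul (K : ℝ)
    exact (h3.mono_left nhdsWithin_le_nhds).eventually (gt_mem_nhds hδ)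
  filter_upwards [self_mem_nhdsWithin, h2] with h hh hK using hsmall h hh hK

/-! ### Length densities -/

namespace IsLengthDensity

variable {F : Plane → Plane → ℝ}

theorem convexOn (hF : IsLengthDensity F) (p : Plane) : ConvexOn ℝ Set.univ (F p) := by
  refine ⟨convex_univ, fun x _ y _ a b ha hb hab => ?_⟩
  obtain rfl : b = 1 - a := by linarith
  exact hF.convex p x y a ha (by linarith)

theorem apply_zero (hF : IsLengthDensity F) (p : Plane) : F p 0 = 0 := by
  obtain ⟨m₁, m₂, -, -, h⟩ := hF.bounds
  have := h p 0
  simp only [norm_zero, mul_zero] at this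
  exact le_antisymm this.2 this.1

theorem nonneg (hF : IsLengthDensity F) (p q : Plane) : 0 ≤ F p q := by
  obtain ⟨m₁, m₂, h₁, -, h⟩ := hF.bounds
  exact (by positivity : 0 ≤ m₁ * ‖q‖).trans (h p q).1

theorem subadditive (hF : IsLengthDensity F) (p q₁ q₂ : Plane) :
    F p (q₁ + q₂) ≤ F p q₁ + F p q₂ := by
  have h1 := hF.convex p q₁ q₂ (1 / 2) (by norm_num) (by norm_num)
  have h2 := hF.homogeneous p ((1 / 2 : ℝ) • q₁ + (1 - 1 / 2 : ℝ) • q₂) 2 two_pos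
  have h3 : (2 : ℝ) • ((1 / 2 : ℝ) • q₁ + (1 - 1 / 2 : ℝ) • q₂) = q₁ + q₂ := by
    rw [smul_add, smul_smul, smul_smul]; norm_num
  rw [h3] at h2
  linarith

/-- Subadditivity and the upper bound make `F p` Lipschitz with a constant independent of `p`. This
upgrades pointwise convergence in `q` to uniform convergence on the unit sphere. -/
theorem exists_abs_sub_le (hF : IsLengthDensity F) :
    ∃ m : ℝ, 0 < m ∧ ∀ p q₁ q₂ : Plane, |F p q₁ - F p q₂| ≤ m * ‖q₁ - q₂‖ := by
  obtain ⟨m₁, m₂, -, h₂, h⟩ := hF.bounds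
  refine ⟨m₂, h₂, fun p q₁ q₂ => abs_sub_le_iff.2 ⟨?_, ?_⟩⟩
  · have h1 := hF.subadditive p q₂ (q₁ - q₂)
    rw [add_sub_cancel] at h1
    linarith [(h p (q₁ - q₂)).2]
  · have h1 := hF.subadditive p q₁ (q₂ - q₁)
    rw [add_sub_cancel] at h1
    rw [norm_sub_rev]
    linarith [(h p (q₂ - q₁)).2]

end IsLengthDensity

theorem intervalIntegrable_lagrangian_of_abs_le {H : Plane → Plane → ℝ}
    (hH : Continuous fun x : Plane × Plane => H x.1 x.2) {u : ℝ → Plane} (hu : u ∈ sobolevLoops)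
    {M : ℝ} (hM : ∀ t q, |H (u t) q| ≤ M * ‖q‖) (a b : ℝ) :
    IntervalIntegrable (fun t => H (u t) (deriv u t)) volume a b := by
  refine ((intervalIntegrable_deriv_of_mem_sobolevLoops hu a b).norm.const_mul M).mono_fun
    (hH.measurable.comp (hu.1.measurable.prodMk (measurable_deriv u))).aestronglyMeasurable ?_
  exact Eventually.of_forall fun t => (hM _ _).trans (le_abs_self _)

theorem IsLengthDensity.intervalIntegrable {F : Plane → Plane → ℝ} (hF : IsLengthDensity F)
    {u : ℝ → Plane} (hu : u ∈ sobolevLoops) (a b : ℝ) :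
    IntervalIntegrable (fun t => F (u t) (deriv u t)) volume a b := by
  obtain ⟨m₁, m₂, -, -, h⟩ := hF.bounds
  refine intervalIntegrable_lagrangian_of_abs_le hF.continuous hu (M := m₂) (fun t q => ?_) a b
  rw [abs_of_nonneg (hF.nonneg _ _)]
  exact (h _ _).2

theorem IsLengthDensity.energy_nonneg {F : Plane → Plane → ℝ} (hF : IsLengthDensity F)
    (u : ℝ → Plane) : 0 ≤ energy F u :=
  intervalIntegral.integral_nonneg zero_le_one fun _ _ => hF.nonneg _ _

theorem IsLengthDensity.minEnergy_le {F : Plane → Plane → ℝ} (hF : IsLengthDensity F) {τ : ℝ}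
    {u : ℝ → Plane} (hu : u ∈ areaClass τ) : minEnergy F τ ≤ energy F u :=
  csInf_le ⟨0, by rintro _ ⟨v, -, rfl⟩; exact hF.energy_nonneg v⟩ ⟨u, hu, rfl⟩

/-! ### Densities asymptotic to a periodic one -/

theorem le_norm_latticePoint (k : ℕ) : (k : ℝ) ≤ ‖latticePoint fun _ => (k : ℤ)‖ := by
  have := PiLp.norm_apply_le (latticePoint fun _ => (k : ℤ)) 0
  simpa [latticePoint] using this

theorem tendsto_add_latticePoint_cobounded (p : Plane) :
    Tendsto (fun k : ℕ => p + latticePoint fun _ => (k : ℤ)) atTop (Bornology.cobounded Plane) := by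
  rw [← tendsto_norm_atTop_iff_cobounded]
  refine tendsto_atTop_mono (fun k => ?_)
    (tendsto_atTop_add_const_right atTop (-‖p‖) (tendsto_natCast_atTop_atTop (R := ℝ)))
  have h1 := norm_sub_le (p + latticePoint fun _ => (k : ℤ)) p
  rw [add_sub_cancel_left] at h1
  linarith [le_norm_latticePoint k]

namespace IsAsymptoticToPeriodic

variable {F Finf : Plane → Plane → ℝ}

/-- Periodicity exhibits `Finf` as a pointwise limit of translates of `F`, through which it inherits
convexity, homogeneity and the bounds. -/
theorem tendsto_translate (h : IsAsymptoticToPeriodic F Finf) (p q : Plane) :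
    Tendsto (fun k : ℕ => F (p + latticePoint fun _ => (k : ℤ)) q) atTop (𝓝 (Finf p q)) := by
  have h1 := (h.tendsto q).comp (tendsto_add_latticePoint_cobounded p)
  have h2 := h1.add_const (Finf p q)
  simpa [Function.comp_def, h.periodic] using h2

theorem isLengthDensity (h : IsAsymptoticToPeriodic F Finf) (hF : IsLengthDensity F) :
    IsLengthDensity Finf := by
  obtain ⟨m₁, m₂, h₁, h₂, hm⟩ := hF.bounds
  refine ⟨h.continuous, fun p q₁ q₂ θ h0 h1 => ?_, fun p q c hc => ?_,
    m₁, m₂, h₁, h₂, fun p q => ⟨?_, ?_⟩⟩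
  · exact le_of_tendsto_of_tendsto' (h.tendsto_translate p _)
      (((h.tendsto_translate p q₁).const_mul θ).add
        ((h.tendsto_translate p q₂).const_mul (1 - θ))) fun k => hF.convex _ _ _ _ h0 h1
  · refine tendsto_nhds_unique (h.tendsto_translate p (c • q)) ?_
    simp only [hF.homogeneous _ _ c hc]
    exact (h.tendsto_translate p q).const_mul c
  · exact ge_of_tendsto' (h.tendsto_translate p q) fun k => (hm _ _).1
  · exact le_of_tendsto' (h.tendsto_translate p q) fun k => (hm _ _).2

/-- The convergence at infinity is uniform in the direction. -/
theorem exists_forall_abs_sub_le (h : IsAsymptoticToPeriodic F Finf) (hF : IsLengthDensity F)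
    {ε : ℝ} (hε : 0 < ε) :
    ∃ R : ℝ, ∀ p : Plane, R ≤ ‖p‖ → ∀ q, |F p q - Finf p q| ≤ ε * ‖q‖ := by
  have hI := h.isLengthDensity hF
  obtain ⟨a, ha, hFa⟩ := hF.exists_abs_sub_le
  obtain ⟨b, hb, hFb⟩ := hI.exists_abs_sub_le
  -- On this finite net the error is below `ε / 2`; moving from a net point to `q` costs at most `(a
  -- + b) * ‖q - x‖ < ε / 2`.
  obtain ⟨t, -, htf, htc⟩ := (isCompact_sphere (0 : Plane) 1).finite_cover_balls
    (e := ε / 2 / (a + b)) (by positivity)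
  have hev : ∀ᶠ p in Bornology.cobounded Plane, ∀ x ∈ t, |F p x - Finf p x| < ε / 2 := by
    rw [eventually_all_finite htf]
    intro x _
    have := (h.tendsto x).abs
    rw [abs_zero] at this
    exact this.eventually (gt_mem_nhds (by positivity))
  obtain ⟨R, -, hR⟩ := (hasBasis_cobounded_norm (E := Plane)).eventually_iff.1 hev
  have hsph : ∀ p : Plane, R ≤ ‖p‖ → ∀ q : Plane, ‖q‖ = 1 → |F p q - Finf p q| ≤ ε := by
    intro p hp q hq
    have hqs : q ∈ Metric.sphere (0 : Plane) 1 := by simpa using hq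
    obtain ⟨x, hx, hqx⟩ := Set.mem_iUnion₂.1 (htc hqs)
    rw [Metric.mem_ball, dist_eq_norm, lt_div_iff₀ (by positivity)] at hqx
    have e1 := abs_le.1 (hFa p q x)
    have e2 := abs_le.1 (hFb p q x)
    have e3 := abs_lt.1 (hR hp x hx)
    rw [abs_le]
    constructor <;> linarith [e1.1, e1.2, e2.1, e2.2, e3.1, e3.2]
  refine ⟨R, fun p hp q => ?_⟩
  rcases eq_or_ne q 0 with rfl | hq
  · simp [hF.apply_zero, hI.apply_zero]
  · have hn : 0 < ‖q‖ := norm_pos_iff.2 hq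
    have h1 := hsph p hp (‖q‖⁻¹ • q) (by rw [norm_smul, norm_inv, norm_norm,
      inv_mul_cancel₀ hn.ne'])
    rw [hF.homogeneous _ _ _ (inv_pos.2 hn), hI.homogeneous _ _ _ (inv_pos.2 hn), ← mul_sub,
      abs_mul, abs_of_pos (inv_pos.2 hn), inv_mul_le_iff₀ hn] at h1
    linarith

theorem abs_energy_sub_le (h : IsAsymptoticToPeriodic F Finf) (hF : IsLengthDensity F)
    {u : ℝ → Plane} (hu : u ∈ sobolevLoops) {ε : ℝ}
    (hε : ∀ t q, |F (u t) q - Finf (u t) q| ≤ ε * ‖q‖) :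
    |energy F u - energy Finf u| ≤ ε * ∫ t in (0 : ℝ)..1, ‖deriv u t‖ := by
  rw [energy_eq_integral_deriv F hu, energy_eq_integral_deriv Finf hu,
    ← intervalIntegral.integral_sub (hF.intervalIntegrable hu _ _)
      ((h.isLengthDensity hF).intervalIntegrable hu _ _),
    ← intervalIntegral.integral_const_mul, ← Real.norm_eq_abs]
  exact intervalIntegral.norm_integral_le_of_norm_le zero_le_one
    (Eventually.of_forall fun t _ => hε t _)
    ((intervalIntegrable_deriv_of_mem_sobolevLoops hu 0 1).norm.const_mul ε)

end IsAsymptoticToPeriodic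

/-! ### The signed area -/

theorem continuous_inner_rot : Continuous fun x : Plane × Plane => inner ℝ x.1 (rot x.2) := by
  simp only [rot, PiLp.inner_apply, Fin.sum_univ_two]
  simp
  fun_prop

theorem inner_rot_eq_neg (p q : Plane) : inner ℝ p (rot q) = -inner ℝ (rot p) q := by
  simp [rot, PiLp.inner_apply, Fin.sum_univ_two]

theorem norm_rot (p : Plane) : ‖rot p‖ = ‖p‖ := by
  simp [rot, EuclideanSpace.norm_eq, Fin.sum_univ_two, add_comm]

theorem inner_rot_smul (p q : Plane) (c : ℝ) : inner ℝ p (rot (c • q)) = c * inner ℝ p (rot q) := by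
  rw [inner_rot_eq_neg, inner_rot_eq_neg, inner_smul_right, mul_neg]

/-- Either sign of `c` is allowed, so lower semicontinuity will bound the limit area from both
sides. -/
theorem convexOn_const_mul_inner_rot (p : Plane) (c : ℝ) :
    ConvexOn ℝ Set.univ fun q : Plane => c * inner ℝ p (rot q) := by
  refine ⟨convex_univ, fun x _ y _ a b _ _ _ => le_of_eq ?_⟩
  simp only [inner_rot_eq_neg, inner_add_right, inner_smul_right, smul_eq_mul]
  ring

/-! ### Loops -/

theorem Function.Periodic.apply_fract {u : ℝ → Plane} (hu : Function.Periodic u 1) (t : ℝ) :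
    u (Int.fract t) = u t := by
  have := hu.sub_zsmul_eq (x := t) ⌊t⌋
  rwa [zsmul_one, Int.self_sub_floor] at this

theorem exists_norm_le_of_mem_sobolevLoops {u : ℝ → Plane} (hu : u ∈ sobolevLoops) :
    ∃ B : ℝ, ∀ t, ‖u t‖ ≤ B := by
  obtain ⟨B, hB⟩ := (isCompact_Icc (a := (0 : ℝ)) (b := 1)).exists_bound_of_continuousOn
    hu.1.continuousOn
  refine ⟨B, fun t => ?_⟩
  rw [← hu.2.1.apply_fract t]
  exact hB _ ⟨Int.fract_nonneg t, (Int.fract_lt_one t).le⟩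

theorem LipschitzWith.norm_sub_apply_zero_le {u : ℝ → Plane} {K : NNReal} (hu : LipschitzWith K u)
    (hp : Function.Periodic u 1) (t : ℝ) : ‖u t - u 0‖ ≤ K := by
  rw [← hp.apply_fract t, ← dist_eq_norm]
  refine (hu.dist_le_mul _ _).trans (mul_le_of_le_one_right K.2 ?_)
  rw [Real.dist_eq, sub_zero, Int.abs_fract]
  exact (Int.fract_lt_one t).le

theorem add_const_mem_sobolevLoops {u : ℝ → Plane} (hu : u ∈ sobolevLoops) (c : Plane) :
    (fun t => u t + c) ∈ sobolevLoops := by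
  obtain ⟨hc, hp, g, hg⟩ := hu
  refine ⟨by fun_prop, fun t => by simp only [hp t], g,
    (by fun_prop : Continuous fun t => u t + c).locallyIntegrable, hg.2, fun φ hφ hφs => ?_⟩
  have hcst := (LipschitzWith.const (α := ℝ) c).hasWeakDeriv.integral_eq φ hφ hφs
  have hi : ∀ {z : ℝ → Plane}, Continuous z → Integrable fun t => deriv φ t • z t := fun hz =>
    Continuous.integrable_of_hasCompactSupport
      ((hφ.continuous_deriv (by simp)).smul hz) hφs.deriv.smul_right
  simp only [smul_add]
  rw [integral_add (hi hc) (hi continuous_const), hcst, hg.integral_eq φ hφ hφs]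
  simp

/-- The extra term pairs a constant vector with the integral of the derivative, which vanishes on a
closed loop. -/
theorem signedArea_add_const {u : ℝ → Plane} (hu : u ∈ sobolevLoops) (c : Plane) :
    signedArea (fun t => u t + c) = signedArea u := by
  rw [signedArea_eq_integral_deriv hu,
    signedArea_eq_integral_deriv (add_const_mem_sobolevLoops hu c)]
  obtain ⟨B, hB⟩ := exists_norm_le_of_mem_sobolevLoops hu
  have hd := intervalIntegrable_deriv_of_mem_sobolevLoops hu 0 1
  have h1 : IntervalIntegrable (fun t => inner ℝ (u t) (rot (deriv u t))) volume 0 1 :=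
    intervalIntegrable_lagrangian_of_abs_le (H := fun p q => inner ℝ p (rot q))
      continuous_inner_rot hu (M := B) (fun t q => by
        refine (abs_real_inner_le_norm _ _).trans ?_
        rw [norm_rot]
        exact mul_le_mul_of_nonneg_right (hB t) (norm_nonneg _)) 0 1
  have h2 : ∫ t in (0 : ℝ)..1, inner ℝ c (rot (deriv u t)) = 0 := by
    simp only [inner_rot_eq_neg]
    have h3 := (innerSL ℝ (rot c)).intervalIntegral_comp_comm hd
    simp only [innerSL_apply_apply] at h3
    rw [intervalIntegral.integral_neg, h3,
      ← sub_eq_integral_deriv_of_mem_sobolevLoops hu zero_le_one]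
    have h4 := hu.2.1 0
    rw [zero_add] at h4
    simp [h4]
  have h5 : IntervalIntegrable (fun t => inner ℝ c (rot (deriv u t))) volume 0 1 := by
    refine intervalIntegrable_lagrangian_of_abs_le (H := fun _ q => inner ℝ c (rot q))
      (continuous_inner_rot.comp (by fun_prop : Continuous fun x : Plane × Plane => (c, x.2))) hu
      (M := ‖c‖) (fun t q => ?_) 0 1
    exact (abs_real_inner_le_norm _ _).trans_eq (by rw [norm_rot])
  simp only [deriv_add_const, inner_add_left]
  rw [intervalIntegral.integral_add h1 h5, h2, add_zero]

theorem IsAsymptoticToPeriodic.energy_add_latticePoint {F Finf : Plane → Plane → ℝ}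
    (h : IsAsymptoticToPeriodic F Finf) {u : ℝ → Plane} (hu : u ∈ sobolevLoops)
    (n : Fin 2 → ℤ) : energy Finf (fun t => u t + latticePoint n) = energy Finf u := by
  rw [energy_eq_integral_deriv _ hu,
    energy_eq_integral_deriv _ (add_const_mem_sobolevLoops hu _)]
  simp only [deriv_add_const, h.periodic]

/-- Arzelà–Ascoli for equi-Lipschitz loops. -/
theorem exists_tendsto_subseq_of_lipschitzWith {v : ℕ → ℝ → Plane} {K : NNReal}
    (hv : ∀ n, LipschitzWith K (v n)) (hp : ∀ n, Function.Periodic (v n) 1) {R : ℝ}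
    (hR : ∀ n t, ‖v n t‖ ≤ R) :
    ∃ φ : ℕ → ℕ, StrictMono φ ∧ ∃ w : ℝ → Plane, LipschitzWith K w ∧ Function.Periodic w 1 ∧
      ∀ t, Tendsto (fun n => v (φ n) t) atTop (𝓝 (w t)) := by
  let f : ℕ → BoundedContinuousFunction (Set.Icc (0 : ℝ) 1) Plane := fun n =>
    BoundedContinuousFunction.mkOfCompact
      ⟨fun t => v n t, (hv n).continuous.comp continuous_subtype_val⟩
  have hcomp := BoundedContinuousFunction.arzela_ascoli (Metric.closedBall (0 : Plane) R)
    (isCompact_closedBall _ _) (Set.range f)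
    (by rintro _ x ⟨n, rfl⟩; simpa [f] using hR n x)
    (by
      refine (LipschitzWith.uniformEquicontinuous _ K ?_).equicontinuous
      rintro ⟨_, n, rfl⟩
      exact LipschitzWith.of_dist_le_mul fun x y => (hv n).dist_le_mul x y)
  obtain ⟨g, -, φ, hφ, hg⟩ := hcomp.tendsto_subseq (x := f)
    fun n => subset_closure (Set.mem_range_self n)
  have hfr : ∀ t : ℝ, Int.fract t ∈ Set.Icc (0 : ℝ) 1 := fun t =>
    ⟨Int.fract_nonneg t, (Int.fract_lt_one t).le⟩
  have hlim : ∀ t, Tendsto (fun n => v (φ n) t) atTop (𝓝 (g ⟨Int.fract t, hfr t⟩)) := by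
    intro t
    have h1 := ((continuous_eval_const (F := BoundedContinuousFunction (Set.Icc (0 : ℝ) 1) Plane)
      (⟨Int.fract t, hfr t⟩ : Set.Icc (0 : ℝ) 1)).tendsto g).comp hg
    refine h1.congr fun n => ?_
    exact (hp (φ n)).apply_fract t
  refine ⟨φ, hφ, fun t => g ⟨Int.fract t, hfr t⟩, ?_, fun t => ?_, hlim⟩
  · refine LipschitzWith.of_dist_le_mul fun x y => ?_
    exact le_of_tendsto' ((hlim x).dist (hlim y)) fun n => (hv _).dist_le_mul x y
  · simp only [Int.fract_add_one]

/-! ### Comparison with the periodic problem and minimizing sequences -/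

theorem add_const_mem_areaClass {u : ℝ → Plane} {τ : ℝ} (hu : u ∈ areaClass τ) (c : Plane) :
    (fun t => u t + c) ∈ areaClass τ :=
  ⟨add_const_mem_sobolevLoops hu.1 c, (signedArea_add_const hu.1 c).trans hu.2⟩

theorem minEnergy_le_minEnergy_periodic {F Finf : Plane → Plane → ℝ} (hF : IsLengthDensity F)
    (h : IsAsymptoticToPeriodic F Finf) (τ : ℝ) : minEnergy F τ ≤ minEnergy Finf τ := by
  rcases (areaClass τ).eq_empty_or_nonempty with hemp | hne
  · simp [minEnergy, hemp]
  refine le_csInf (hne.image _) ?_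
  rintro _ ⟨u, hu, rfl⟩
  refine le_of_forall_pos_le_add fun ε hε => ?_
  set D := ∫ t in (0 : ℝ)..1, ‖deriv u t‖ with hD
  have hD0 : 0 ≤ D := intervalIntegral.integral_nonneg zero_le_one fun _ _ => norm_nonneg _
  -- The total error is at most `ε * D / (D + 1) ≤ ε`; the `+ 1` covers constant loops, where `D =
  -- 0`.
  obtain ⟨R, hR⟩ := h.exists_forall_abs_sub_le hF (ε := ε / (D + 1)) (by positivity)
  obtain ⟨B, hB⟩ := exists_norm_le_of_mem_sobolevLoops hu.1
  obtain ⟨k, hk⟩ := exists_nat_ge (R + B)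
  have hn := le_norm_latticePoint k
  set n : Fin 2 → ℤ := fun _ => (k : ℤ)
  have hv := add_const_mem_areaClass hu (latticePoint n)
  have h1 := h.abs_energy_sub_le hF hv.1 (ε := ε / (D + 1)) fun t q => by
    refine hR _ ?_ q
    have h2 := norm_sub_le (u t + latticePoint n) (u t)
    rw [add_sub_cancel_left] at h2
    linarith [hB t]
  simp only [deriv_add_const] at h1
  rw [h.energy_add_latticePoint hu.1, ← hD] at h1
  have h3 : ε / (D + 1) * D ≤ ε := by
    rw [div_mul_eq_mul_div, div_le_iff₀ (by positivity)]
    nlinarith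
  linarith [hF.minEnergy_le hv, (abs_le.1 h1).2]

/-- A minimizing sequence consisting of equi-Lipschitz loops. -/
theorem IsLengthDensity.exists_lipschitz_minimizing_seq {F : Plane → Plane → ℝ}
    (hF : IsLengthDensity F) {τ : ℝ} (hne : (areaClass τ).Nonempty) :
    ∃ (K : NNReal) (v : ℕ → ℝ → Plane), (∀ n, LipschitzWith K (v n)) ∧
      (∀ n, v n ∈ areaClass τ) ∧
      Tendsto (fun n => energy F (v n)) atTop (𝓝 (minEnergy F τ)) := by
  obtain ⟨m₁, m₂, hm₁, -, hm⟩ := hF.bounds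
  set S := minEnergy F τ with hS
  -- Energy at most `S + 1` forces length at most `(S + 1) / m₁`; the last `1` is the perturbation
  -- of arc length in the reparametrization.
  have key : ∀ n : ℕ, ∃ v, LipschitzWith ((S + 1) / m₁ + 1).toNNReal v ∧ v ∈ areaClass τ ∧
      energy F v ≤ S + 1 / ((n : ℝ) + 1) := by
    intro n
    have hpos : (0 : ℝ) < 1 / ((n : ℝ) + 1) := by positivity
    have hlt : sInf (energy F '' areaClass τ) < S + 1 / ((n : ℝ) + 1) := by
      rw [hS, minEnergy] at *; linarith
    obtain ⟨_, ⟨u, hu, rfl⟩, hun⟩ := exists_lt_of_csInf_lt (hne.image _) hlt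
    obtain ⟨v, hvL, hvp, hv⟩ := exists_lipschitz_reparametrization hu.1
    have hvs := hvL.mem_sobolevLoops hvp
    have hdi := intervalIntegrable_deriv_of_mem_sobolevLoops hu.1 0 1
    have hlen : m₁ * ∫ t in (0 : ℝ)..1, ‖deriv u t‖ ≤ energy F u := by
      rw [energy_eq_integral_deriv F hu.1, ← intervalIntegral.integral_const_mul]
      exact intervalIntegral.integral_mono_on zero_le_one (hdi.norm.const_mul _)
        (hF.intervalIntegrable hu.1 _ _) fun t _ => (hm _ _).1
    have hone : 1 / ((n : ℝ) + 1) ≤ 1 := by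
      rw [div_le_one (by positivity)]; simp
    refine ⟨v, hvL.weaken (Real.toNNReal_le_toNNReal ?_), ⟨hvs, ?_⟩, ?_⟩
    · rw [intervalIntegral.integral_add hdi.norm intervalIntegrable_const]
      have h1 : ∫ t in (0 : ℝ)..1, ‖deriv u t‖ ≤ (S + 1) / m₁ := by
        rw [le_div_iff₀ hm₁]; linarith
      simpa using h1
    · rw [← hu.2, signedArea_eq_integral_deriv hvs, signedArea_eq_integral_deriv hu.1,
        hv (fun p q => inner ℝ p (rot q)) fun p q c _ => inner_rot_smul p q c]
    · rw [energy_eq_integral_deriv F hvs, hv F hF.homogeneous, ← energy_eq_integral_deriv F hu.1]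
      exact hun.le
  choose v hv1 hv2 hv3 using key
  refine ⟨_, v, hv1, hv2, ?_⟩
  refine tendsto_of_tendsto_of_tendsto_of_le_of_le tendsto_const_nhds ?_
    (fun n => hF.minEnergy_le (hv2 n)) hv3
  simpa using (tendsto_one_div_add_atTop_nhds_zero_nat (𝕜 := ℝ)).const_add S

/-- A minimizing sequence that escapes to infinity does not beat the periodic density. -/
theorem IsAsymptoticToPeriodic.minEnergy_le_of_escaping {F Finf : Plane → Plane → ℝ}
    (h : IsAsymptoticToPeriodic F Finf) (hF : IsLengthDensity F) {τ : ℝ} {K : NNReal}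
    {v : ℕ → ℝ → Plane} (hv : ∀ n, LipschitzWith K (v n)) (hva : ∀ n, v n ∈ areaClass τ)
    {S : ℝ} (hS : Tendsto (fun n => energy F (v n)) atTop (𝓝 S))
    (hesc : ∀ R : ℝ, ∀ᶠ n in atTop, R < ‖v n 0‖) : minEnergy Finf τ ≤ S := by
  refine le_of_forall_pos_le_add fun ε hε => ?_
  obtain ⟨R, hR⟩ := h.exists_forall_abs_sub_le hF (ε := ε / (K + 1)) (by positivity)
  refine ge_of_tendsto (hS.add_const ε) ?_
  filter_upwards [hesc (R + K)] with n hn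
  have h1 := h.abs_energy_sub_le hF (hva n).1 (ε := ε / (K + 1)) fun t q => by
    refine hR _ ?_ q
    have h2 := (hv n).norm_sub_apply_zero_le (hva n).1.2.1 t
    have h3 := norm_sub_norm_le (v n 0) (v n t)
    rw [norm_sub_rev] at h3
    linarith
  have h4 : ∫ t in (0 : ℝ)..1, ‖deriv (v n) t‖ ≤ K := by
    have h5 := intervalIntegral.integral_mono_on zero_le_one
      (intervalIntegrable_deriv_of_mem_sobolevLoops (hva n).1 0 1).norm
      (intervalIntegrable_const (c := (K : ℝ)))
      fun t _ => norm_deriv_le_of_lipschitz (hv n) (x₀ := t)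
    simpa using h5
  have h6 : ε / (K + 1) * ∫ t in (0 : ℝ)..1, ‖deriv (v n) t‖ ≤ ε := by
    refine (mul_le_mul_of_nonneg_left h4 (by positivity)).trans ?_
    rw [div_mul_eq_mul_div, div_le_iff₀ (by positivity)]
    nlinarith
  linarith [(h.isLengthDensity hF).minEnergy_le (hva n), (abs_le.1 h1).1]

/-- A uniformly bounded equi-Lipschitz minimizing sequence produces a minimizer. -/
theorem IsLengthDensity.exists_minimizer_of_bounded {F : Plane → Plane → ℝ}
    (hF : IsLengthDensity F) {τ : ℝ} {K : NNReal} {v : ℕ → ℝ → Plane}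
    (hv : ∀ n, LipschitzWith K (v n)) (hva : ∀ n, v n ∈ areaClass τ)
    (hS : Tendsto (fun n => energy F (v n)) atTop (𝓝 (minEnergy F τ))) {R : ℝ}
    (hR : ∀ n t, ‖v n t‖ ≤ R) :
    ∃ u ∈ areaClass τ, LipschitzWith K u ∧ energy F u = minEnergy F τ := by
  have hvp : ∀ n, Function.Periodic (v n) 1 := fun n => (hva n).1.2.1
  obtain ⟨φ, hφ, w, hw, hwp, hlim⟩ := exists_tendsto_subseq_of_lipschitzWith hv hvp hR
  have hws := hw.mem_sobolevLoops hwp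
  -- The values `c = 1` and `c = -1` give the two inequalities between `signedArea w` and `τ`.
  have hA : ∀ c : ℝ, c * (2 * signedArea w) ≤ c * (2 * τ) := by
    intro c
    have hval : ∀ z ∈ sobolevLoops,
        ∫ t in (0 : ℝ)..1, c * inner ℝ (z t) (rot (deriv z t)) = c * (2 * signedArea z) := by
      intro z hz
      rw [signedArea_eq_integral_deriv hz, intervalIntegral.integral_const_mul]
      ring
    rw [← hval w hws]
    refine integral_lagrangian_le_of_tendsto (H := fun p q => c * inner ℝ p (rot q))
      (continuous_inner_rot.const_mul c) (fun p => convexOn_const_mul_inner_rot p c)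
      (fun n => hv (φ n)) (fun n => hvp (φ n)) hw (fun n t => hR (φ n) t) hlim ?_
    refine tendsto_const_nhds.congr fun n => ?_
    rw [hval _ (hva (φ n)).1, (hva (φ n)).2]
  have hwa : w ∈ areaClass τ := ⟨hws, by linarith [hA 1, hA (-1)]⟩
  refine ⟨w, hwa, hw, le_antisymm ?_ (hF.minEnergy_le hwa)⟩
  rw [energy_eq_integral_deriv F hws]
  refine integral_lagrangian_le_of_tendsto hF.continuous hF.convexOn
    (fun n => hv (φ n)) (fun n => hvp (φ n)) hw (fun n t => hR (φ n) t) hlim ?_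
  refine (hS.comp hφ.tendsto_atTop).congr fun n => ?_
  exact energy_eq_integral_deriv F (hva (φ n)).1

theorem mainTheorem2 (F Finf : Plane → Plane → ℝ) (hF : IsLengthDensity F)
    (hFinf : IsAsymptoticToPeriodic F Finf) :
    (∀ τ : ℝ, minEnergy F τ ≤ minEnergy Finf τ) ∧
    ∀ τ : ℝ, minEnergy F τ < minEnergy Finf τ →
      ∃ u ∈ areaClass τ, (∃ K : NNReal, LipschitzWith K u) ∧
        energy F u = minEnergy F τ := by
  refine ⟨minEnergy_le_minEnergy_periodic hF hFinf, fun τ hτ => ?_⟩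
  -- On an empty class both infima take the default value `0`, against the strict inequality.
  have hne : (areaClass τ).Nonempty := by
    by_contra hemp
    rw [Set.not_nonempty_iff_eq_empty] at hemp
    simp [minEnergy, hemp] at hτ
  obtain ⟨K, v, hv, hva, hS⟩ := hF.exists_lipschitz_minimizing_seq hne
  by_cases hesc : ∀ R : ℝ, ∀ᶠ n in atTop, R < ‖v n 0‖
  · exact absurd (hFinf.minEnergy_le_of_escaping hF hv hva hS hesc) (not_le.2 hτ)
  · push Not at hesc
    obtain ⟨R, hR⟩ := hesc
    -- Failure to escape gives a subsequence with base points in the ball of radius `R`; the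
    -- Lipschitz bound over one period keeps the whole loops within `R + K`.
    obtain ⟨φ, hφ, hφR⟩ := extraction_of_frequently_atTop hR
    obtain ⟨u, hu, huK, huE⟩ := hF.exists_minimizer_of_bounded (fun n => hv (φ n))
      (fun n => hva (φ n)) (hS.comp hφ.tendsto_atTop) (R := R + K) fun n t => by
        have h1 := (hv (φ n)).norm_sub_apply_zero_le (hva (φ n)).1.2.1 t
        have h2 := norm_sub_norm_le (v (φ n) t) (v (φ n) 0)
        linarith [hφR n]
    exact ⟨u, hu, ⟨K, huK⟩, huE⟩
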